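/- Let $r\ge 1$ and let $\mathbf n=(n_1,\ldots,n_r)$, $\mathbf d=(d_1,\ldots,d_r)$ be $r$-tuples of positive integers. Let $H_{n,d}$ be the space of real homogeneous polynomials of degree $d$ in $x_0,\ldots,x_n$, with the Bombieri–Weyl inner product, for which the scaled monomials $\mathbf m_\alpha=\sqrt{\tfrac{d!}{\alpha_0!\cdots\alpha_n!}}\,x^\alpha$, $|\alpha|=d$, form an orthonormal basis. Let $\mathscr H_{\mathbf n,\mathbf d}=H_{n_1,d_1}\otimes\cdots\otimes H_{n_r,d_r}$ carry the inner product for which the tensors $\mathbf m_{\alpha_1}\otimes\cdots\otimes\mathbf m_{\alpha_r}$ form an orthonormal basis. Let $\widehat{\mathbb V}_{n,d}=\{\pm\ell^d \mid \ell \text{ a real linear form in } x_0,\ldots,x_n\}\subset H_{n,d}$, and let the spherical Segre–Veronese manifold be $$\mathbb X_{\mathbf n,\mathbf d}=\{f_1\otimes\cdots\otimes f_r \mid f_i\in\widehat{\mathbb V}_{n_i,d_i}\}\cap\{F\in\mathscr H_{\mathbf n,\mathbf d} : \|F\|=1\},$$ a submanifold of dimension $n_1+\cdots+n_r$. Then its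 $(n_1+\cdots+n_r)$-dimensional volume is $$\mathrm{vol}(\mathbb X_{\mathbf n,\mathbf d})=\frac{\sqrt{d_1^{n_1}\cdots d_r^{n_r}}}{2^{r-1}}\cdot\mathrm{vol}(\mathbb S^{n_1})\cdots\mathrm{vol}(\mathbb S^{n_r}),$$ where $\mathbb S^k$ is the unit sphere in $\mathbb R^{k+1}$ and $\mathrm{vol}(\mathbb S^{k})$ is its $k$-dimensional volume. -/

import Mathlib

open MeasureTheory
open scoped TensorProduct

noncomputable section

namespace SegreVeronese

/-- The exponents `α = (α₀, …, αₙ)` of the monomials of degree `d` in `x₀, …, xₙ`. -/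
abbrev MultiIndex (n d : ℕ) : Type := {α : Fin (n + 1) →₀ ℕ // α.degree = d}

instance (n d : ℕ) : Fintype (MultiIndex n d) :=
  Fintype.subtype (Finset.finsuppAntidiag Finset.univ d) (by
    intro α
    simp [Finset.mem_finsuppAntidiag, Finsupp.degree_eq_sum])

/-- `H_{n,d}`: real homogeneous polynomials of degree `d` in the `n + 1` variables `x₀, …, xₙ`. -/
abbrev H (n d : ℕ) : Submodule ℝ (MvPolynomial (Fin (n + 1)) ℝ) :=
  MvPolynomial.homogeneousSubmodule (Fin (n + 1)) ℝ d

/-- The scaled monomial `m_α = √(d! / (α₀! ⋯ αₙ!)) x^α`. -/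
def scaledMonomial {n d : ℕ} (α : MultiIndex n d) : H n d :=
  ⟨MvPolynomial.monomial α.1 (√(α.1.multinomial : ℝ)),
    (MvPolynomial.mem_homogeneousSubmodule _ _).2 (MvPolynomial.isHomogeneous_monomial _ α.2)⟩

theorem sqrt_multinomial_ne_zero {n : ℕ} (α : Fin (n + 1) →₀ ℕ) :
    √(α.multinomial : ℝ) ≠ 0 := by
  refine (Real.sqrt_pos.2 ?_).ne'
  rw [Finsupp.multinomial_eq]
  exact_mod_cast Nat.multinomial_pos _ _

/-- The Bombieri–Weyl coordinates: `f = ∑_α f_α m_α` with `f_α = coeff_α(f) / √(multinomial α)`. -/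
def bwCoord (n d : ℕ) : H n d ≃ₗ[ℝ] (MultiIndex n d → ℝ) where
  toFun f α := MvPolynomial.coeff α.1 (f : MvPolynomial (Fin (n + 1)) ℝ) / √(α.1.multinomial : ℝ)
  invFun c := ∑ α, c α • scaledMonomial α
  map_add' f g := by
    ext α
    simp [add_div]
  map_smul' a f := by
    ext α
    simp [mul_div_assoc]
  left_inv f := by
    apply Subtype.ext
    apply MvPolynomial.ext
    intro β
    simp only [scaledMonomial, AddSubmonoidClass.coe_finsetSum, Submodule.coe_smul,
      MvPolynomial.coeff_sum, MvPolynomial.coeff_smul, MvPolynomial.coeff_monomial, smul_eq_mul,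
      mul_ite, mul_zero]
    by_cases hβ : β.degree = d
    · rw [Finset.sum_eq_single (⟨β, hβ⟩ : MultiIndex n d)]
      · simpa using div_mul_cancel₀ _ (sqrt_multinomial_ne_zero β)
      · intro α _ hα
        rw [if_neg]
        intro h
        exact hα (Subtype.ext h)
      · simp
    · rw [Finset.sum_eq_zero]
      · exact (((MvPolynomial.mem_homogeneousSubmodule _ _).1 f.2).coeff_eq_zero hβ).symm
      · intro α _
        rw [if_neg]
        intro h
        exact hβ (h ▸ α.2)
  right_inv c := by
    ext β
    simp only [scaledMonomial, AddSubmonoidClass.coe_finsetSum, Submodule.coe_smul,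
      MvPolynomial.coeff_sum, MvPolynomial.coeff_smul, MvPolynomial.coeff_monomial, smul_eq_mul,
      mul_ite, mul_zero]
    rw [Finset.sum_eq_single β]
    · simpa using mul_div_cancel_right₀ _ (sqrt_multinomial_ne_zero β.1)
    · intro α _ hα
      rw [if_neg]
      intro h
      exact hα (Subtype.ext h)
    · simp

/-- The basis `(m_α)` of `H_{n,d}`; the Bombieri–Weyl inner product makes it orthonormal. -/
def bwBasis (n d : ℕ) : Module.Basis (MultiIndex n d) ℝ (H n d) :=
  Module.Basis.ofEquivFun (bwCoord n d)

theorem bwBasis_apply {n d : ℕ} (α : MultiIndex n d) : bwBasis n d α = scaledMonomial α := by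
  classical
  rw [bwBasis, Module.Basis.coe_ofEquivFun]
  change ∑ β, (Pi.single α (1 : ℝ) : MultiIndex n d → ℝ) β • scaledMonomial β = _
  simp [Pi.single_apply]

/-- The cone `{± ℓ^d | ℓ a linear form in x₀, …, xₙ}` over the spherical Veronese variety. -/
def veroneseCone (n d : ℕ) : Set (H n d) :=
  {f | ∃ ℓ : MvPolynomial (Fin (n + 1)) ℝ, ℓ.IsHomogeneous 1 ∧
    ((f : MvPolynomial (Fin (n + 1)) ℝ) = ℓ ^ d ∨ (f : MvPolynomial (Fin (n + 1)) ℝ) = -(ℓ ^ d))}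

variable {r : ℕ}

/-- The space `H_{n₁,d₁} ⊗ ⋯ ⊗ H_{n_r,d_r}` of partially symmetric tensors. -/
def TensorSpace (n d : Fin r → ℕ) : Type := ⨂[ℝ] i, H (n i) (d i)

instance (n d : Fin r → ℕ) : AddCommGroup (TensorSpace n d) :=
  inferInstanceAs (AddCommGroup (⨂[ℝ] i, H (n i) (d i)))

instance (n d : Fin r → ℕ) : Module ℝ (TensorSpace n d) :=
  inferInstanceAs (Module ℝ (⨂[ℝ] i, H (n i) (d i)))

/-- The decomposable tensor `f₁ ⊗ ⋯ ⊗ f_r`. -/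
def tprod {n d : Fin r → ℕ} (f : ∀ i, H (n i) (d i)) : TensorSpace n d :=
  PiTensorProduct.tprod ℝ f

/-- The basis `m_{α₁} ⊗ ⋯ ⊗ m_{α_r}`. The coordinates of `F` in it are the numbers
`F_{α₁,…,α_r}`. -/
def tensorBasis (n d : Fin r → ℕ) :
    Module.Basis (∀ i, MultiIndex (n i) (d i)) ℝ (TensorSpace n d) :=
  Basis.piTensorProduct fun i => bwBasis (n i) (d i)

theorem tensorBasis_apply (n d : Fin r → ℕ) (α : ∀ i, MultiIndex (n i) (d i)) :
    tensorBasis n d α = tprod fun i => scaledMonomial (α i) := by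
  refine (Basis.piTensorProduct_apply _ _).trans ?_
  simp only [bwBasis_apply]
  rfl

/-- The inner product `⟨F, G⟩ = ∑ F_{α₁,…,α_r} G_{α₁,…,α_r}`. -/
@[reducible] def tensorInnerCore (n d : Fin r → ℕ) : InnerProductSpace.Core ℝ (TensorSpace n d) where
  inner F G := ∑ α, (tensorBasis n d).repr F α * (tensorBasis n d).repr G α
  conj_inner_symm F G := by
    simp [mul_comm]
  re_inner_nonneg F := by
    simpa using Finset.sum_nonneg fun α _ => mul_self_nonneg ((tensorBasis n d).repr F α)
  add_left F G K := by
    simp [add_mul, Finset.sum_add_distrib]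
  smul_left F G a := by
    simp [Finset.mul_sum, mul_assoc]
  definite F h := by
    rw [Finset.sum_eq_zero_iff_of_nonneg (fun α _ => mul_self_nonneg _)] at h
    apply (tensorBasis n d).ext_elem
    intro α
    simpa using h α (Finset.mem_univ α)

instance (n d : Fin r → ℕ) : NormedAddCommGroup (TensorSpace n d) :=
  (tensorInnerCore n d).toNormedAddCommGroup

instance (n d : Fin r → ℕ) : InnerProductSpace ℝ (TensorSpace n d) :=
  InnerProductSpace.ofCore (tensorInnerCore n d).toCore

theorem inner_def (n d : Fin r → ℕ) (F G : TensorSpace n d) :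
    inner ℝ F G = ∑ α, (tensorBasis n d).repr F α * (tensorBasis n d).repr G α := rfl

instance (n d : Fin r → ℕ) : MeasurableSpace (TensorSpace n d) := borel _

instance (n d : Fin r → ℕ) : BorelSpace (TensorSpace n d) := ⟨rfl⟩

/-- The spherical Segre–Veronese manifold `X_{n,d}`: the decomposable tensors `f₁ ⊗ ⋯ ⊗ f_r` with
all `f_i` in the Veronese cones, intersected with the unit sphere. -/
def manifold (n d : Fin r → ℕ) : Set (TensorSpace n d) :=
  {F | ∃ f : ∀ i, H (n i) (d i), (∀ i, f i ∈ veroneseCone (n i) (d i)) ∧ F = tprod f} ∩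
    Metric.sphere 0 1

/-- The `m`-dimensional volume of a subset of a Euclidean space: the `m`-dimensional Hausdorff
measure, normalized to agree with Lebesgue measure on `ℝᵐ`. On an embedded `m`-dimensional
submanifold this is its Riemannian volume for the induced metric. -/
def vol {E : Type*} [NormedAddCommGroup E] [InnerProductSpace ℝ E] [MeasurableSpace E]
    [BorelSpace E] (m : ℕ) (S : Set E) : ENNReal :=
  Measure.euclideanHausdorffMeasure m S

/-- The unit sphere `𝕊ᵏ` in `ℝᵏ⁺¹`. -/
def unitSphere (k : ℕ) : Set (EuclideanSpace ℝ (Fin (k + 1))) := Metric.sphere 0 1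

end SegreVeronese

end

noncomputable section

namespace SegreVeronese

open scoped NNReal ENNReal Topology

/-! By the multinomial theorem the Bombieri–Weyl product of `ℓ_u ^ d` and `ℓ_v ^ d` is `⟨u, v⟩ ^ d`,
so decomposable powers pair to `∏ ⟨u i, v i⟩ ^ d i` (`inner_segreVeronese`). For unit vectors the
squared distance of the images is therefore `2 (1 - ∏ (1 - ‖u i - v i‖² / 2) ^ d i)`, which is `∑ d
i ‖u i - v i‖²` to leading order: the Segre–Veronese map is infinitesimally an isometry from the
product of spheres of radii `√(d i)`. Together with a global sign, it maps `{±1} × ∏ 𝕊^{n i}` onto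
the manifold, and every fibre has `2 ^ r` points. Hence `2 ^ r vol(X) = 2 ∏ √(d i) ^ n i vol(𝕊^{n
i})`.

No area formula is used. The spheres are cut into finitely many small measurable pieces. On a
product of pieces, the map is compared by Lipschitz bounds with a product of orthogonal projections
to Euclidean spaces, where Hausdorff measure is Lebesgue measure and factors
(`volume_image_product_bounds`). Summing with the multiplicity from `card_pieces_containing` gives
the formula up to powers of `K > 1`; then `K → 1`. -/

/-! ### Hausdorff measure, product volumes and small pieces of spheres -/

/-- The hypothesis makes `f` factor through `g` on `s` by a `K`-Lipschitz map, even when `g` is not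
injective. -/
theorem euclideanHausdorffMeasure_image_le {α X Y : Type*}
    [EMetricSpace X] [MeasurableSpace X] [BorelSpace X]
    [EMetricSpace Y] [MeasurableSpace Y] [BorelSpace Y]
    (m : ℕ) {f : α → X} {g : α → Y} {s : Set α} {K : ℝ≥0}
    (h : ∀ a ∈ s, ∀ b ∈ s, edist (f a) (f b) ≤ K * edist (g a) (g b)) :
    μHE[m] (f '' s) ≤ (K : ℝ≥0∞) ^ m * μHE[m] (g '' s) := by
  rcases s.eq_empty_or_nonempty with rfl | ⟨a₀, -⟩
  · simp
  have : Nonempty α := ⟨a₀⟩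
  have hL : LipschitzOnWith K (f ∘ Function.invFunOn g s) (g '' s) := by
    rintro _ ⟨a, ha, rfl⟩ _ ⟨b, hb, rfl⟩
    have ha' : ∃ x ∈ s, g x = g a := ⟨a, ha, rfl⟩
    have hb' : ∃ x ∈ s, g x = g b := ⟨b, hb, rfl⟩
    have := h _ (Function.invFunOn_mem ha') _ (Function.invFunOn_mem hb')
    rwa [Function.invFunOn_eq ha', Function.invFunOn_eq hb'] at this
  have himg : f '' s = (f ∘ Function.invFunOn g s) '' (g '' s) := by
    rw [Set.image_image]
    refine Set.image_congr fun a ha => ?_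
    have ha' : ∃ x ∈ s, g x = g a := ⟨a, ha, rfl⟩
    have := h a ha _ (Function.invFunOn_mem ha')
    rw [Function.invFunOn_eq ha', edist_self, mul_zero, nonpos_iff_eq_zero, edist_eq_zero] at this
    exact this
  rw [himg]
  have := hL.hausdorffMeasure_image_le (d := m) (Nat.cast_nonneg m)
  rw [ENNReal.rpow_natCast] at this
  rw [Measure.euclideanHausdorffMeasure_def, Measure.euclideanHausdorffMeasure_def,
    Measure.smul_apply, Measure.smul_apply, ENNReal.smul_def, ENNReal.smul_def, smul_eq_mul,
    smul_eq_mul, mul_left_comm]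
  gcongr

theorem mem_parallelepiped_orthonormalBasis {ι E : Type*} [Fintype ι] [NormedAddCommGroup E]
    [InnerProductSpace ℝ E] (b : OrthonormalBasis ι ℝ E) (x : E) :
    x ∈ parallelepiped b ↔ ∀ i, b.repr x i ∈ Set.Icc (0 : ℝ) 1 := by
  classical
  rw [mem_parallelepiped_iff]
  constructor
  · rintro ⟨t, ht, rfl⟩ i
    have : b.repr (∑ j, t j • b j) i = t i := by
      simp [b.repr_self, Finset.sum_apply, Pi.single_apply]
    rw [this]
    exact ⟨ht.1 i, ht.2 i⟩
  · intro h
    exact ⟨fun i => b.repr x i, ⟨fun i => (h i).1, fun i => (h i).2⟩, (b.sum_repr x).symm⟩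

/-- Both sides come from Haar measures on the product, so it suffices that they agree on one box,
spanned by orthonormal bases of the factors. -/
theorem volume_piLp_preimage_pi {ι : Type*} [Fintype ι] (V : ι → Type*)
    [∀ i, NormedAddCommGroup (V i)] [∀ i, InnerProductSpace ℝ (V i)]
    [∀ i, FiniteDimensional ℝ (V i)] [∀ i, MeasurableSpace (V i)] [∀ i, BorelSpace (V i)]
    (s : ∀ i, Set (V i)) :
    (volume : Measure (PiLp 2 V)) (WithLp.ofLp ⁻¹' Set.univ.pi s) = ∏ i, volume (s i) := by
  let e : PiLp 2 V ≃ᵐ (∀ i, V i) := (MeasurableEquiv.toLp 2 (∀ i, V i)).symm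
  let L : PiLp 2 V ≃L[ℝ] (∀ i, V i) := PiLp.continuousLinearEquiv 2 ℝ V
  let ν : Measure (∀ i, V i) := (volume : Measure (PiLp 2 V)).map L
  have : ν.IsAddHaarMeasure := L.isAddHaarMeasure_map volume
  let μ : Measure (∀ i, V i) := Measure.pi fun i => volume
  let B : ∀ i, OrthonormalBasis (Fin (Module.finrank ℝ (V i))) ℝ (V i) :=
    fun i => stdOrthonormalBasis ℝ (V i)
  let K : Set (∀ i, V i) := Set.univ.pi fun i => parallelepiped (B i)
  have hμK : μ K = 1 := by
    rw [Measure.pi_pi]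
    simp [OrthonormalBasis.volume_parallelepiped]
  have hνK : ν K = 1 := by
    have : ν K = volume (L ⁻¹' K) := e.map_apply K
    rw [this]
    have h2 : L ⁻¹' K = parallelepiped (Pi.orthonormalBasis B) := by
      ext x
      rw [mem_parallelepiped_orthonormalBasis]
      simp only [K, L, Set.mem_preimage, Set.mem_univ_pi, mem_parallelepiped_orthonormalBasis, Sigma.forall]
      rfl
    rw [h2, OrthonormalBasis.volume_parallelepiped]
  have hνμ : ν = μ := by
    have h := Measure.isAddLeftInvariant_eq_smul ν μ
    have h1 := congrArg (fun m : Measure _ => m K) h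
    simp only [Measure.smul_apply] at h1
    rw [hμK, hνK, ENNReal.smul_def, smul_eq_mul, mul_one] at h1
    have h2 : Measure.addHaarScalarFactor ν μ = 1 := by exact_mod_cast h1.symm
    rw [h, h2, one_smul]
  calc (volume : Measure (PiLp 2 V)) (WithLp.ofLp ⁻¹' Set.univ.pi s) = ν (Set.univ.pi s) :=
        (e.map_apply _).symm
    _ = _ := by rw [hνμ, Measure.pi_pi]

/-- Orthogonal projection onto `pᗮ`, read in an orthonormal basis; it flattens the sphere near `p`.
-/
theorem exists_projection_along {n : ℕ} {p : EuclideanSpace ℝ (Fin (n + 1))} (hp : ‖p‖ = 1) :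
    ∃ π : EuclideanSpace ℝ (Fin (n + 1)) →ₗ[ℝ] EuclideanSpace ℝ (Fin n),
      ∀ x, ‖π x‖ ^ 2 = ‖x‖ ^ 2 - inner ℝ p x ^ 2 := by
  have hp0 : p ≠ 0 := by
    rintro rfl
    simp at hp
  have : Fact (Module.finrank ℝ (EuclideanSpace ℝ (Fin (n + 1))) = n + 1) := ⟨by simp⟩
  let b := OrthonormalBasis.fromOrthogonalSpanSingleton (𝕜 := ℝ) n hp0
  refine ⟨b.repr.toLinearEquiv.toLinearMap ∘ₗ
    ((ℝ ∙ p)ᗮ.orthogonalProjectionOnto : _ →ₗ[ℝ] _), fun x => ?_⟩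
  have h1 := Submodule.norm_sq_eq_add_norm_sq_projection x (ℝ ∙ p)
  have h2 : ‖(ℝ ∙ p).orthogonalProjectionOnto x‖ ^ 2 = inner ℝ p x ^ 2 := by
    change ‖((ℝ ∙ p).orthogonalProjectionOnto x : EuclideanSpace ℝ (Fin (n + 1)))‖ ^ 2 = _
    rw [Submodule.coe_orthogonalProjectionOnto_apply,
      Submodule.starProjection_unit_singleton ℝ hp, norm_smul, hp, mul_one, Real.norm_eq_abs,
      sq_abs]
  rw [h2] at h1
  simp only [LinearMap.comp_apply, LinearEquiv.coe_coe, LinearIsometryEquiv.coe_toLinearEquiv,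
    LinearIsometryEquiv.norm_map, ContinuousLinearMap.coe_coe]
  linarith

/-- A chord of the sphere is orthogonal to its midpoint, so `p` may be replaced by its difference
from the midpoint, of norm at most `δ`. Thus projection along `p` hardly shortens chords near `p`.
-/
theorem inner_sub_sq_le {E : Type*} [NormedAddCommGroup E] [InnerProductSpace ℝ E] {p x y : E}
    {δ : ℝ} (hx : ‖x‖ = 1) (hy : ‖y‖ = 1) (hpx : dist x p ≤ δ) (hpy : dist y p ≤ δ) :
    inner ℝ p (x - y) ^ 2 ≤ δ ^ 2 * ‖x - y‖ ^ 2 := by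
  have h0 : inner ℝ (x + y) (x - y) = (0 : ℝ) :=
    (real_inner_add_sub_eq_zero_iff x y).2 (hx.trans hy.symm)
  have h1 : inner ℝ p (x - y) = inner ℝ (p - (1 / 2 : ℝ) • (x + y)) (x - y) := by
    rw [inner_sub_left, inner_smul_left, h0]
    simp
  have h2 : ‖p - (1 / 2 : ℝ) • (x + y)‖ ≤ δ := by
    have : p - (1 / 2 : ℝ) • (x + y) = (1 / 2 : ℝ) • (p - x) + (1 / 2 : ℝ) • (p - y) := by
      module
    rw [this]
    refine (norm_add_le _ _).trans ?_
    rw [norm_smul, norm_smul, ← dist_eq_norm, ← dist_eq_norm, dist_comm p x, dist_comm p y]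
    norm_num
    linarith
  rw [h1, ← mul_pow, ← sq_abs]
  gcongr
  exact (abs_real_inner_le_norm _ _).trans (by gcongr)

theorem exists_sphere_partition {E : Type*} [NormedAddCommGroup E] [NormedSpace ℝ E]
    [FiniteDimensional ℝ E] [MeasurableSpace E] [BorelSpace E] {δ : ℝ} (hδ : 0 < δ) :
    ∃ (k : ℕ) (A : Fin k → Set E), (∀ j, MeasurableSet (A j)) ∧ Pairwise (Function.onFun Disjoint A) ∧
      ⋃ j, A j = Metric.sphere (0 : E) 1 ∧ ∀ j, ∃ p : E, ‖p‖ = 1 ∧ A j ⊆ Metric.ball p δ := by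
  have : ProperSpace E := FiniteDimensional.proper_real E
  obtain ⟨t, hts, htf, hcov⟩ := (isCompact_sphere (0 : E) 1).finite_cover_balls hδ
  obtain ⟨k, c, -, hc⟩ := htf.fin_param
  let B : Fin k → Set E := fun j => Metric.sphere (0 : E) 1 ∩ Metric.ball (c j) δ
  have hB : ∀ j, MeasurableSet (B j) := fun j =>
    Metric.isClosed_sphere.measurableSet.inter measurableSet_ball
  refine ⟨k, disjointed B, fun j => disjointedRec (fun _ _ ht => ht.diff (hB _)) (hB j), disjoint_disjointed B, ?_,
    fun j => ⟨c j, ?_, ?_⟩⟩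
  · rw [iUnion_disjointed]
    ext x
    simp only [B, Set.mem_iUnion, Set.mem_inter_iff]
    refine ⟨fun ⟨_, h, _⟩ => h, fun h => ?_⟩
    obtain ⟨y, hy, hxy⟩ := Set.mem_iUnion₂.1 (hcov h)
    rw [← hc] at hy
    obtain ⟨j, rfl⟩ := hy
    exact ⟨j, h, hxy⟩
  · have : c j ∈ t := hc ▸ Set.mem_range_self j
    simpa using hts this
  · exact (disjointed_subset B j).trans Set.inter_subset_right

/-- The elementary estimate behind the infinitesimal isometry of Segre–Veronese maps. -/
theorem one_sub_prod_pow_bounds {ι : Type*} [Fintype ι] (d : ι → ℕ) (t : ι → ℝ)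
    (h0 : ∀ i, 0 ≤ t i) (h1 : ∀ i, t i ≤ 1) :
    1 - ∏ i, (1 - t i) ^ d i ≤ ∑ i, d i * t i ∧
      ∑ i, d i * t i ≤ (1 + ∑ i, d i * t i) * (1 - ∏ i, (1 - t i) ^ d i) := by
  have hs : 0 ≤ ∑ i, d i * t i := Finset.sum_nonneg fun i _ => mul_nonneg (by positivity) (h0 i)
  constructor
  · have key : ∀ s : Finset ι, 1 - ∑ i ∈ s, d i * t i ≤ ∏ i ∈ s, (1 - t i) ^ d i ∧
        ∏ i ∈ s, (1 - t i) ^ d i ≤ 1 := by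
      intro s
      induction s using Finset.cons_induction with
      | empty => simp
      | cons a s ha ih =>
        rw [Finset.sum_cons, Finset.prod_cons]
        have hb : 1 - d a * t a ≤ (1 - t a) ^ d a := by
          have := one_add_mul_le_pow (a := -t a) (by linarith [h1 a]) (d a)
          rw [← sub_eq_add_neg] at this
          linarith
        have hp0 : 0 ≤ (1 - t a) ^ d a := pow_nonneg (by linarith [h1 a]) _
        have hp1 : (1 - t a) ^ d a ≤ 1 := pow_le_one₀ (by linarith [h1 a]) (by linarith [h0 a])
        have hq0 : 0 ≤ ∏ i ∈ s, (1 - t i) ^ d i :=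
          Finset.prod_nonneg fun i _ => pow_nonneg (by linarith [h1 i]) _
        constructor
        · nlinarith [ih.1, ih.2]
        · exact mul_le_one₀ hp1 hq0 ih.2
    linarith [(key Finset.univ).1]
  · have hexp : ∏ i, (1 - t i) ^ d i ≤ Real.exp (-∑ i, d i * t i) := by
      rw [← Finset.sum_neg_distrib, Real.exp_sum]
      refine Finset.prod_le_prod (fun i _ => pow_nonneg (by linarith [h1 i]) _) fun i _ => ?_
      rw [← mul_neg, Real.exp_nat_mul]
      exact pow_le_pow_left₀ (by linarith [h1 i]) (Real.one_sub_le_exp_neg _) _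
    have h2 : (1 + ∑ i, d i * t i) * Real.exp (-∑ i, d i * t i) ≤ 1 := by
      rw [Real.exp_neg, ← div_eq_mul_inv, div_le_one (Real.exp_pos _)]
      linarith [Real.add_one_le_exp (∑ i, d i * t i)]
    nlinarith

/-! ### The Segre–Veronese map and its inner products -/

/-- The linear form with coefficient vector `u`. -/
def linearForm {n : ℕ} (u : EuclideanSpace ℝ (Fin (n + 1))) : MvPolynomial (Fin (n + 1)) ℝ :=
  (Finsupp.equivFunOnFinite.symm u.ofLp).linearCombination ℝ MvPolynomial.X

theorem linearForm_eq_sum {n : ℕ} (u : EuclideanSpace ℝ (Fin (n + 1))) :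
    linearForm u = ∑ j, u j • MvPolynomial.X j := by
  rw [linearForm, Finsupp.linearCombination_apply, Finsupp.sum_fintype _ _ (by simp)]
  rfl

theorem linearForm_isHomogeneous {n : ℕ} (u : EuclideanSpace ℝ (Fin (n + 1))) :
    (linearForm u).IsHomogeneous 1 := by
  rw [linearForm_eq_sum, ← MvPolynomial.mem_homogeneousSubmodule]
  exact Submodule.sum_mem _ fun j _ => Submodule.smul_mem _ _ (MvPolynomial.isHomogeneous_X ℝ j)

theorem exists_linearForm_eq {n : ℕ} {ℓ : MvPolynomial (Fin (n + 1)) ℝ} (h : ℓ.IsHomogeneous 1) :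
    ∃ u, linearForm u = ℓ := by
  refine ⟨WithLp.toLp 2 fun j => ℓ.coeff (Finsupp.single j 1), ?_⟩
  rw [linearForm_eq_sum]
  ext α
  simp only [MvPolynomial.coeff_sum, MvPolynomial.coeff_smul, MvPolynomial.coeff_X, smul_eq_mul,
    mul_ite, mul_one, mul_zero]
  by_cases hα : α.degree = 1
  · obtain ⟨j, rfl⟩ := (Finsupp.sum_eq_one_iff α).1 hα
    rw [Finset.sum_eq_single j]
    · simp
    · intro i _ hi
      rw [if_neg]
      intro h'
      exact hi (Finsupp.single_left_injective one_ne_zero h')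
    · simp
  · rw [h.coeff_eq_zero hα]
    refine Finset.sum_eq_zero fun i _ => if_neg ?_
    rintro rfl
    simp at hα

theorem linearForm_smul {n : ℕ} (c : ℝ) (u : EuclideanSpace ℝ (Fin (n + 1))) :
    linearForm (c • u) = c • linearForm u := by
  simp [linearForm_eq_sum, Finset.smul_sum, smul_smul]

/-- The Veronese map `u ↦ (∑ⱼ uⱼ xⱼ) ^ d`. -/
def veronese {n : ℕ} (d : ℕ) (u : EuclideanSpace ℝ (Fin (n + 1))) : H n d :=
  ⟨linearForm u ^ d, by simpa using (linearForm_isHomogeneous u).pow d⟩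

theorem veronese_smul {n : ℕ} (d : ℕ) (c : ℝ) (u : EuclideanSpace ℝ (Fin (n + 1))) :
    veronese d (c • u) = c ^ d • veronese d u := by
  apply Subtype.ext
  simp [veronese, linearForm_smul, smul_pow]

theorem bwBasis_repr_veronese {n d : ℕ} (u : EuclideanSpace ℝ (Fin (n + 1)))
    (α : MultiIndex n d) :
    (bwBasis n d).repr (veronese d u) α = √(α.1.multinomial : ℝ) * ∏ j, u j ^ α.1 j := by
  have h : (bwBasis n d).repr (veronese d u) α =
      MvPolynomial.coeff α.1 (linearForm u ^ d) / √(α.1.multinomial : ℝ) := rfl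
  have hα : (α.1.sum fun _ m => m) = d := α.2
  rw [h, linearForm, MvPolynomial.coeff_linearCombination_X_pow, if_pos hα,
    Finsupp.prod_fintype _ _ (by simp), div_eq_iff (sqrt_multinomial_ne_zero α.1)]
  have := Real.mul_self_sqrt (Nat.cast_nonneg (α := ℝ) α.1.multinomial)
  simp only [Finsupp.equivFunOnFinite_symm_apply_apply]
  linear_combination (-∏ j, u j ^ α.1 j) * this

/-- This is the multinomial expansion of `(∑ u j v j) ^ d`: the two square roots multiply to the
multinomial coefficient. -/
theorem sum_repr_veronese_mul {n : ℕ} (d : ℕ) (u v : EuclideanSpace ℝ (Fin (n + 1))) :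
    ∑ α, (bwBasis n d).repr (veronese d u) α * (bwBasis n d).repr (veronese d v) α =
      inner ℝ u v ^ d := by
  have h1 : inner ℝ u v = ∑ j, u j * v j := by
    simp [PiLp.inner_apply, mul_comm]
  rw [h1, Finset.sum_pow_eq_sum_piAntidiag]
  symm
  refine Finset.sum_bij' (fun k hk => (⟨Finsupp.equivFunOnFinite.symm k, ?_⟩ : MultiIndex n d))
    (fun α _ => ⇑α.1) ?_ ?_ ?_ ?_ ?_
  · rw [Finset.mem_piAntidiag] at hk
    rw [Finsupp.degree_eq_sum]
    exact hk.1
  · simp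
  · intro α _
    rw [Finset.mem_piAntidiag]
    exact ⟨by rw [← Finsupp.degree_eq_sum]; exact α.2, by simp⟩
  · simp
  · intro α _
    apply Subtype.ext
    ext
    simp
  · intro k hk
    rw [bwBasis_repr_veronese, bwBasis_repr_veronese,
      Finsupp.multinomial_eq_of_support_subset (Finset.subset_univ _)]
    have := Real.mul_self_sqrt (Nat.cast_nonneg (α := ℝ) (Nat.multinomial Finset.univ k))
    simp only [Finsupp.coe_equivFunOnFinite_symm, mul_pow, Finset.prod_mul_distrib]
    linear_combination (-((∏ j, u j ^ k j) * ∏ j, v j ^ k j)) * this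

variable {r : ℕ}

theorem inner_tprod (n d : Fin r → ℕ) (f g : ∀ i, H (n i) (d i)) :
    inner ℝ (tprod f) (tprod g) =
      ∏ i, ∑ α, (bwBasis (n i) (d i)).repr (f i) α * (bwBasis (n i) (d i)).repr (g i) α := by
  rw [inner_def, Finset.prod_univ_sum]
  refine Finset.sum_congr (by ext; simp) fun α _ => ?_
  have h : ∀ f : ∀ i, H (n i) (d i),
      (tensorBasis n d).repr (tprod f) α = ∏ i, (bwBasis (n i) (d i)).repr (f i) (α i) :=
    fun f => Basis.piTensorProduct_repr_tprod_apply _ _ _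
  rw [h, h, Finset.prod_mul_distrib]

/-- The Segre–Veronese map `u ↦ ℓ_{u₁}^{d₁} ⊗ ⋯ ⊗ ℓ_{u_r}^{d_r}`. -/
def segreVeronese {n : Fin r → ℕ} (d : Fin r → ℕ) (u : ∀ i, EuclideanSpace ℝ (Fin (n i + 1))) :
    TensorSpace n d :=
  tprod fun i => veronese (d i) (u i)

theorem inner_segreVeronese {n d : Fin r → ℕ} (u v : ∀ i, EuclideanSpace ℝ (Fin (n i + 1))) :
    inner ℝ (segreVeronese d u) (segreVeronese d v) = ∏ i, inner ℝ (u i) (v i) ^ d i := by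
  simp only [segreVeronese, inner_tprod, sum_repr_veronese_mul]

theorem tprod_smul {n d : Fin r → ℕ} (c : Fin r → ℝ) (f : ∀ i, H (n i) (d i)) :
    tprod (fun i => c i • f i) = (∏ i, c i) • tprod f :=
  MultilinearMap.map_smul_univ (PiTensorProduct.tprod ℝ) c f

theorem segreVeronese_smul {n d : Fin r → ℕ} (c : Fin r → ℝ)
    (u : ∀ i, EuclideanSpace ℝ (Fin (n i + 1))) :
    segreVeronese d (fun i => c i • u i) = (∏ i, c i ^ d i) • segreVeronese d u := by
  simp only [segreVeronese, veronese_smul]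
  exact tprod_smul (fun i => c i ^ d i) _

theorem norm_segreVeronese_sq {n d : Fin r → ℕ} (u : ∀ i, EuclideanSpace ℝ (Fin (n i + 1))) :
    ‖segreVeronese d u‖ ^ 2 = (∏ i, ‖u i‖ ^ d i) ^ 2 := by
  rw [← real_inner_self_eq_norm_sq, inner_segreVeronese, ← Finset.prod_pow]
  refine Finset.prod_congr rfl fun i _ => ?_
  rw [real_inner_self_eq_norm_sq, ← pow_mul, ← pow_mul, mul_comm]

theorem norm_segreVeronese {n d : Fin r → ℕ} (u : ∀ i, EuclideanSpace ℝ (Fin (n i + 1))) :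
    ‖segreVeronese d u‖ = ∏ i, ‖u i‖ ^ d i :=
  (sq_eq_sq₀ (norm_nonneg _) (Finset.prod_nonneg fun _ _ => by positivity)).1
    (norm_segreVeronese_sq u)

/-- The manifold is the image of the product of the unit spheres under `± segreVeronese d`. -/
theorem mem_manifold_iff (hr : 1 ≤ r) {n d : Fin r → ℕ} (hd : ∀ i, 1 ≤ d i) (F : TensorSpace n d) :
    F ∈ manifold n d ↔ ∃ (ε : ℤˣ) (u : ∀ i, EuclideanSpace ℝ (Fin (n i + 1))),
      (∀ i, ‖u i‖ = 1) ∧ F = ((ε : ℤ) : ℝ) • segreVeronese d u := by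
  constructor
  · rintro ⟨⟨f, hf, rfl⟩, hF⟩
    have h1 : ∀ i, ∃ (e : ℤˣ) (w : EuclideanSpace ℝ (Fin (n i + 1))),
        f i = ((e : ℤ) : ℝ) • veronese (d i) w := by
      intro i
      obtain ⟨ℓ, hℓ, h⟩ := hf i
      obtain ⟨w, rfl⟩ := exists_linearForm_eq hℓ
      rcases h with h | h
      · exact ⟨1, w, Subtype.ext (by simp [h, veronese])⟩
      · exact ⟨-1, w, Subtype.ext (by simp [h, veronese])⟩
    choose e w hw using h1
    have h2 : tprod f = ((∏ i, (e i : ℤˣ) : ℤˣ) : ℤ) • segreVeronese d w := by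
      have : f = fun i => ((e i : ℤ) : ℝ) • veronese (d i) (w i) := funext hw
      rw [this, tprod_smul (fun i => ((e i : ℤ) : ℝ)), ← Int.cast_smul_eq_zsmul ℝ]
      simp [segreVeronese]
    rw [← Int.cast_smul_eq_zsmul ℝ] at h2
    set ε : ℤˣ := ∏ i, e i
    have h3 : ∏ i, ‖w i‖ ^ d i = 1 := by
      rw [← norm_segreVeronese]
      have : ‖tprod f‖ = 1 := by simpa using hF
      rw [h2, norm_smul] at this
      rcases Int.units_eq_one_or ε with h | h <;> simpa [h] using this
    have hw0 : ∀ i, ‖w i‖ ≠ 0 := by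
      intro i hi
      refine zero_ne_one (α := ℝ) ?_
      rw [← h3, eq_comm, Finset.prod_eq_zero_iff]
      exact ⟨i, Finset.mem_univ i, by rw [hi, zero_pow (by have := hd i; omega)]⟩
    refine ⟨ε, fun i => ‖w i‖⁻¹ • w i, fun i => ?_, ?_⟩
    · rw [norm_smul, norm_inv, norm_norm, inv_mul_cancel₀ (hw0 i)]
    · rw [segreVeronese_smul, h2]
      have : ∏ i, (‖w i‖⁻¹) ^ d i = 1 := by
        simp only [inv_pow, Finset.prod_inv_distrib, h3, inv_one]
      rw [this, one_smul]
  · rintro ⟨ε, u, hu, rfl⟩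
    constructor
    -- The global sign is absorbed into one factor, which exists because `1 ≤ r`.
    · let i₀ : Fin r := ⟨0, hr⟩
      refine ⟨fun i => (if i = i₀ then ((ε : ℤ) : ℝ) else 1) • veronese (d i) (u i), fun i => ?_, ?_⟩
      · refine ⟨linearForm (u i), linearForm_isHomogeneous _, ?_⟩
        by_cases hi : i = i₀
        · rcases Int.units_eq_one_or ε with h | h <;> simp [hi, h, veronese]
        · left
          simp [hi, veronese]
      · rw [tprod_smul (fun i => if i = i₀ then ((ε : ℤ) : ℝ) else 1)]
        simp [segreVeronese]
    · rw [mem_sphere_zero_iff_norm, norm_smul, norm_segreVeronese]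
      rcases Int.units_eq_one_or ε with h | h <;> simp [h, hu]

theorem continuous_segreVeronese {n : Fin r → ℕ} (d : Fin r → ℕ) :
    Continuous (segreVeronese (n := n) d) := by
  rw [continuous_iff_continuousAt]
  intro u
  rw [ContinuousAt, tendsto_iff_norm_sub_tendsto_zero]
  have h : ∀ v, ‖segreVeronese d v - segreVeronese d u‖ =
      √(inner ℝ (segreVeronese d v) (segreVeronese d v) -
        2 * inner ℝ (segreVeronese d v) (segreVeronese d u) +
        inner ℝ (segreVeronese d u) (segreVeronese d u)) := by
    intro v
    rw [real_inner_self_eq_norm_sq, real_inner_self_eq_norm_sq, ← norm_sub_sq_real,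
      Real.sqrt_sq (norm_nonneg _)]
  simp only [h, inner_segreVeronese]
  have hc : Continuous fun v : ∀ i, EuclideanSpace ℝ (Fin (n i + 1)) =>
      √(∏ i, inner ℝ (v i) (v i) ^ d i - 2 * ∏ i, inner ℝ (v i) (u i) ^ d i +
        ∏ i, inner ℝ (u i) (u i) ^ d i) := by fun_prop
  convert hc.tendsto u using 2
  ring_nf
  simp

/-! ### Metric and volume comparison on small pieces -/

theorem norm_smul_sub_smul_sq_le {r : ℕ} {n d : Fin r → ℕ} {c : ℝ} (hc : |c| = 1)
    {u v : ∀ i, EuclideanSpace ℝ (Fin (n i + 1))} (hu : ∀ i, ‖u i‖ = 1) (hv : ∀ i, ‖v i‖ = 1)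
    {η : ℝ} (hη : η ≤ 1) (huv : ∀ i, ‖u i - v i‖ ^ 2 ≤ 2 * η) :
    ‖c • segreVeronese d u - c • segreVeronese d v‖ ^ 2 ≤ ∑ i, d i * ‖u i - v i‖ ^ 2 ∧
      ∑ i, d i * ‖u i - v i‖ ^ 2 ≤
        (1 + ∑ i, d i * η) * ‖c • segreVeronese d u - c • segreVeronese d v‖ ^ 2 := by
  have hin : ∀ i, inner ℝ (u i) (v i) = 1 - ‖u i - v i‖ ^ 2 / 2 := by
    intro i
    rw [norm_sub_sq_real, hu, hv]
    ring
  have hn : ‖c • segreVeronese d u - c • segreVeronese d v‖ ^ 2 =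
      2 * (1 - ∏ i, (1 - ‖u i - v i‖ ^ 2 / 2) ^ d i) := by
    rw [← smul_sub, norm_smul, Real.norm_eq_abs, hc, one_mul, norm_sub_sq_real,
      norm_segreVeronese, norm_segreVeronese, inner_segreVeronese]
    simp only [hu, hv, hin, one_pow, Finset.prod_const_one]
    ring
  obtain ⟨h1, h2⟩ := one_sub_prod_pow_bounds d (fun i => ‖u i - v i‖ ^ 2 / 2)
    (fun i => by positivity) (fun i => by linarith [huv i])
  have hs : ∑ i, d i * ‖u i - v i‖ ^ 2 = 2 * ∑ i, d i * (‖u i - v i‖ ^ 2 / 2) := by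
    rw [Finset.mul_sum]
    exact Finset.sum_congr rfl fun i _ => by ring
  have hle : ∑ i, d i * (‖u i - v i‖ ^ 2 / 2) ≤ ∑ i, d i * η :=
    Finset.sum_le_sum fun i _ => by
      have := huv i
      gcongr
      linarith
  have hpos : 0 ≤ ‖c • segreVeronese d u - c • segreVeronese d v‖ ^ 2 := by positivity
  rw [hn] at hpos ⊢
  rw [hs]
  constructor
  · linarith
  · nlinarith

theorem edist_le_of_norm_sq_le {X Y : Type*} [NormedAddCommGroup X] [NormedAddCommGroup Y]
    {a b : X} {a' b' : Y} {K : ℝ≥0} (h : ‖a - b‖ ^ 2 ≤ (K : ℝ) ^ 2 * ‖a' - b'‖ ^ 2) :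
    edist a b ≤ K * edist a' b' := by
  rw [edist_nndist, edist_nndist, ← ENNReal.coe_mul, ENNReal.coe_le_coe, ← NNReal.coe_le_coe,
    NNReal.coe_mul, coe_nndist, coe_nndist, dist_eq_norm, dist_eq_norm]
  rw [← mul_pow] at h
  exact (sq_le_sq₀ (norm_nonneg _) (by positivity)).1 h

/-- The image and the product of pieces are both compared with the flat model `g`. `h1` bounds the
distortion of the projections, `h2` that of the Segre–Veronese map; the second inequality pays for
both. -/
theorem volume_image_product_bounds {r : ℕ} {n d : Fin r → ℕ} (hd : ∀ i, 1 ≤ d i) {K : ℝ≥0} {δ : ℝ}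
    (h1 : 1 ≤ (K : ℝ) ^ 2 * (1 - δ ^ 2)) (h2 : 1 + ∑ i, d i * (2 * δ ^ 2) ≤ (K : ℝ) ^ 2)
    (h3 : 2 * δ ^ 2 ≤ 1) {A : ∀ i, Set (EuclideanSpace ℝ (Fin (n i + 1)))}
    (hA : ∀ i, ∃ p, ‖p‖ = 1 ∧ A i ⊆ Metric.ball p δ) (hS : ∀ i, A i ⊆ Metric.sphere 0 1)
    {c : ℝ} (hc : |c| = 1) :
    μHE[∑ i, n i] ((fun u => c • segreVeronese d u) '' Set.univ.pi A) ≤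
        (K : ℝ≥0∞) ^ (∑ i, n i) * ∏ i, (‖√(d i : ℝ)‖₊ : ℝ≥0∞) ^ n i * μHE[n i] (A i) ∧
      ∏ i, (‖√(d i : ℝ)‖₊ : ℝ≥0∞) ^ n i * μHE[n i] (A i) ≤
        ((K : ℝ≥0∞) * K) ^ (∑ i, n i) *
          μHE[∑ i, n i] ((fun u => c • segreVeronese d u) '' Set.univ.pi A) := by
  choose p hp hAp using hA
  choose π hπ using fun i => exists_projection_along (hp i)
  let g : (∀ i, EuclideanSpace ℝ (Fin (n i + 1))) → PiLp 2 fun i => EuclideanSpace ℝ (Fin (n i)) :=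
    fun u => WithLp.toLp 2 fun i => √(d i : ℝ) • π i (u i)
  let B : ∀ i, Set (EuclideanSpace ℝ (Fin (n i))) := fun i => (fun x => √(d i : ℝ) • π i x) '' A i
  have hg : ∀ u v, ‖g u - g v‖ ^ 2 = ∑ i, d i * ‖π i (u i - v i)‖ ^ 2 := by
    intro u v
    rw [PiLp.norm_sq_eq_of_L2]
    refine Finset.sum_congr rfl fun i _ => ?_
    have : (g u - g v) i = √(d i : ℝ) • π i (u i - v i) := by
      simp [g, smul_sub]
    rw [this, norm_smul, mul_pow, Real.norm_eq_abs, sq_abs, Real.sq_sqrt (Nat.cast_nonneg _)]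
  have hπle : ∀ i x, ‖π i x‖ ^ 2 ≤ ‖x‖ ^ 2 := fun i x => by
    rw [hπ]
    linarith [sq_nonneg (inner ℝ (p i) x : ℝ)]
  have hπge : ∀ i, ∀ x ∈ A i, ∀ y ∈ A i, ‖x - y‖ ^ 2 ≤ (K : ℝ) ^ 2 * ‖π i (x - y)‖ ^ 2 := by
    intro i x hx y hy
    have h4 := inner_sub_sq_le (p := p i) (δ := δ) (mem_sphere_zero_iff_norm.1 (hS i hx))
      (mem_sphere_zero_iff_norm.1 (hS i hy)) (hAp i hx).le (hAp i hy).le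
    rw [hπ]
    have h5 : 0 ≤ ‖x - y‖ ^ 2 := by positivity
    have h6 : (1 - δ ^ 2) * ‖x - y‖ ^ 2 ≤ ‖x - y‖ ^ 2 - inner ℝ (p i) (x - y) ^ 2 := by linarith
    calc ‖x - y‖ ^ 2 ≤ (K : ℝ) ^ 2 * (1 - δ ^ 2) * ‖x - y‖ ^ 2 := le_mul_of_one_le_left h5 h1
      _ = (K : ℝ) ^ 2 * ((1 - δ ^ 2) * ‖x - y‖ ^ 2) := by ring
      _ ≤ _ := by gcongr
  have hest : ∀ u ∈ Set.univ.pi A, ∀ v ∈ Set.univ.pi A,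
      ‖c • segreVeronese d u - c • segreVeronese d v‖ ^ 2 ≤ ∑ i, d i * ‖u i - v i‖ ^ 2 ∧
      ∑ i, d i * ‖u i - v i‖ ^ 2 ≤
        (K : ℝ) ^ 2 * ‖c • segreVeronese d u - c • segreVeronese d v‖ ^ 2 := by
    intro u hu v hv
    -- Here `η = 2 δ²`: points of a ball of radius `δ` have squared distance at most `4 δ² = 2 η`.
    obtain ⟨ha, hb⟩ := norm_smul_sub_smul_sq_le (d := d) (u := u) (v := v) hc
      (fun i => mem_sphere_zero_iff_norm.1 (hS i (hu i trivial)))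
      (fun i => mem_sphere_zero_iff_norm.1 (hS i (hv i trivial))) h3 (fun i => by
        have hx := hAp i (hu i trivial)
        have hy := hAp i (hv i trivial)
        rw [Metric.mem_ball] at hx hy
        have hxy : ‖u i - v i‖ ≤ 2 * δ := by
          rw [← dist_eq_norm]
          linarith [dist_triangle_right (u i) (v i) (p i)]
        have := pow_le_pow_left₀ (norm_nonneg _) hxy 2
        linarith)
    exact ⟨ha, hb.trans (by gcongr)⟩
  have hfg : μHE[∑ i, n i] ((fun u => c • segreVeronese d u) '' Set.univ.pi A) ≤
      (K : ℝ≥0∞) ^ (∑ i, n i) * μHE[∑ i, n i] (g '' Set.univ.pi A) := by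
    refine euclideanHausdorffMeasure_image_le _ fun u hu v hv => edist_le_of_norm_sq_le ?_
    rw [hg, Finset.mul_sum]
    refine (hest u hu v hv).1.trans (Finset.sum_le_sum fun i _ => ?_)
    rw [mul_left_comm]
    exact mul_le_mul_of_nonneg_left (hπge i _ (hu i trivial) _ (hv i trivial)) (Nat.cast_nonneg _)
  have hgf : μHE[∑ i, n i] (g '' Set.univ.pi A) ≤ (K : ℝ≥0∞) ^ (∑ i, n i) *
      μHE[∑ i, n i] ((fun u => c • segreVeronese d u) '' Set.univ.pi A) := by
    refine euclideanHausdorffMeasure_image_le _ fun u hu v hv => edist_le_of_norm_sq_le ?_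
    rw [hg]
    refine le_trans (Finset.sum_le_sum fun i _ => ?_) (hest u hu v hv).2
    exact mul_le_mul_of_nonneg_left (hπle i _) (Nat.cast_nonneg _)
  have hprod : μHE[∑ i, n i] (g '' Set.univ.pi A) = ∏ i, μHE[n i] (B i) := by
    have hrank : Module.finrank ℝ (PiLp 2 fun i => EuclideanSpace ℝ (Fin (n i))) = ∑ i, n i := by
      rw [(WithLp.linearEquiv 2 ℝ (∀ i, EuclideanSpace ℝ (Fin (n i)))).finrank_eq,
        Module.finrank_pi_fintype]
      simp
    have himg : g '' Set.univ.pi A = WithLp.ofLp ⁻¹' Set.univ.pi B := by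
      ext y
      simp only [Set.mem_image, Set.mem_preimage, Set.mem_univ_pi, B]
      constructor
      · rintro ⟨u, hu, rfl⟩ i
        exact ⟨u i, hu i, rfl⟩
      · intro h
        choose u hu huy using h
        exact ⟨u, hu, congrArg (WithLp.toLp 2) (funext huy)⟩
    have h := InnerProductSpace.euclideanHausdorffMeasure_eq_volume
      (V := PiLp 2 fun i => EuclideanSpace ℝ (Fin (n i)))
    rw [hrank] at h
    rw [h, himg, volume_piLp_preimage_pi]
    simp only [EuclideanSpace.euclideanHausdorffMeasure_eq_volume]
  have hscale : ∀ i, (‖√(d i : ℝ)‖₊ : ℝ≥0∞) ^ n i * μHE[n i] (A i) =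
      μHE[n i] ((fun x => √(d i : ℝ) • x) '' A i) := by
    intro i
    have h0 : √(d i : ℝ) ≠ 0 := (Real.sqrt_pos.2 (by exact_mod_cast hd i)).ne'
    have := Measure.euclideanHausdorffMeasure_smul₀ (n i) h0 (A i)
    rw [ENNReal.smul_def, smul_eq_mul, ENNReal.coe_pow] at this
    exact this.symm
  have hB1 : ∀ i, μHE[n i] (B i) ≤ (‖√(d i : ℝ)‖₊ : ℝ≥0∞) ^ n i * μHE[n i] (A i) := by
    intro i
    rw [hscale]
    have := euclideanHausdorffMeasure_image_le (n i) (f := fun x => √(d i : ℝ) • π i x)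
      (g := fun x => √(d i : ℝ) • x) (s := A i) (K := 1) fun x _ y _ => edist_le_of_norm_sq_le (by
        rw [← smul_sub, ← smul_sub, ← map_sub, norm_smul, norm_smul, mul_pow, mul_pow]
        rw [NNReal.coe_one, one_pow, one_mul]
        exact mul_le_mul_of_nonneg_left (hπle i (x - y)) (sq_nonneg _))
    simpa using this
  have hB2 : ∀ i, (‖√(d i : ℝ)‖₊ : ℝ≥0∞) ^ n i * μHE[n i] (A i) ≤
      (K : ℝ≥0∞) ^ n i * μHE[n i] (B i) := by
    intro i
    rw [hscale]
    refine euclideanHausdorffMeasure_image_le (n i) fun x hx y hy => edist_le_of_norm_sq_le ?_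
    rw [← smul_sub, ← smul_sub, ← map_sub, norm_smul, norm_smul, mul_pow, mul_pow, mul_left_comm]
    exact mul_le_mul_of_nonneg_left (hπge i x hx y hy) (sq_nonneg _)
  constructor
  · refine hfg.trans ?_
    rw [hprod]
    gcongr with i
    exact hB1 i
  · calc _ ≤ ∏ i, (K : ℝ≥0∞) ^ n i * μHE[n i] (B i) := Finset.prod_le_prod' fun i _ => hB2 i
      _ = (K : ℝ≥0∞) ^ (∑ i, n i) * μHE[∑ i, n i] (g '' Set.univ.pi A) := by
        rw [Finset.prod_mul_distrib, Finset.prod_pow_eq_pow_sum, hprod]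
      _ ≤ _ := by
        rw [mul_pow, mul_assoc]
        gcongr

/-! ### Fibres and multiplicities -/

theorem sum_measure_eq_card_mul {α ι : Type*} [Fintype ι] [MeasurableSpace α] (μ : Measure α)
    {S : ι → Set α} (hS : ∀ i, MeasurableSet (S i)) {X : Set α} (hX : ⋃ i, S i = X) {N : ℕ}
    (hN : ∀ x ∈ X, Nat.card {i // x ∈ S i} = N) : ∑ i, μ (S i) = N * μ X := by
  classical
  have hXm : MeasurableSet X := hX ▸ MeasurableSet.iUnion hS
  calc ∑ i, μ (S i) = ∑ i, ∫⁻ x, (S i).indicator 1 x ∂μ := by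
        simp only [lintegral_indicator_one (hS _)]
    _ = ∫⁻ x, ∑ i, (S i).indicator 1 x ∂μ :=
        (lintegral_finsetSum _ fun i _ => measurable_one.indicator (hS i)).symm
    _ = ∫⁻ x, N * X.indicator 1 x ∂μ := by
        refine lintegral_congr fun x => ?_
        by_cases hx : x ∈ X
        · have := hN x hx
          rw [Nat.card_eq_fintype_card, Fintype.card_subtype] at this
          simp [Set.indicator_apply, hx, ← this]
        · have : ∀ i, x ∉ S i := fun i hi => hx (hX ▸ Set.mem_iUnion.2 ⟨i, hi⟩)
          simp [hx, this]
    _ = N * μ X := by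
        rw [lintegral_const_mul _ (measurable_one.indicator hXm), lintegral_indicator_one hXm]

theorem abs_units_cast (e : ℤˣ) : |((e : ℤ) : ℝ)| = 1 := by
  rcases Int.units_eq_one_or e with h | h <;> simp [h]

/-- Pairing with the image of `v` gives `∏ |⟨u i, v i⟩| ^ d i = 1` with all factors at most `1`, so
Cauchy–Schwarz is an equality in each factor. -/
theorem exists_unit_smul_of_segreVeronese_eq {r : ℕ} {n d : Fin r → ℕ} (hd : ∀ i, 1 ≤ d i)
    {ε ε' : ℤˣ} {u v : ∀ i, EuclideanSpace ℝ (Fin (n i + 1))} (hu : ∀ i, ‖u i‖ = 1)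
    (hv : ∀ i, ‖v i‖ = 1)
    (h : ((ε : ℤ) : ℝ) • segreVeronese d u = ((ε' : ℤ) : ℝ) • segreVeronese d v) :
    ∃ σ : Fin r → ℤˣ, (∀ i, v i = ((σ i : ℤ) : ℝ) • u i) ∧ ε' = ε * ∏ i, σ i ^ d i := by
  have h1 : ∏ i, |inner ℝ (u i) (v i)| ^ d i = 1 := by
    have h2 := congrArg (fun F => |inner ℝ F (segreVeronese d v)|) h
    simp only [inner_smul_left, inner_segreVeronese, abs_mul, Finset.abs_prod, abs_pow,
      real_inner_self_eq_norm_sq] at h2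
    simpa [abs_units_cast, norm_segreVeronese, hv] using h2
  have hle : ∀ i, |inner ℝ (u i) (v i)| ≤ 1 := fun i => by
    simpa [hu, hv] using abs_real_inner_le_norm (u i) (v i)
  have h3 : ∀ i, |inner ℝ (u i) (v i)| = 1 := by
    intro i
    refine le_antisymm (hle i) ?_
    rw [← h1, ← Finset.mul_prod_erase _ _ (Finset.mem_univ i)]
    refine (mul_le_of_le_one_right (by positivity) (Finset.prod_le_one (fun _ _ => by positivity)
      fun j _ => pow_le_one₀ (abs_nonneg _) (hle j))).trans ?_
    exact pow_le_of_le_one (abs_nonneg _) (hle i) (by have := hd i; omega)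
  have h4 : ∀ i, ∃ s : ℤˣ, v i = ((s : ℤ) : ℝ) • u i := by
    intro i
    rcases (abs_eq zero_le_one).1 (h3 i) with h | h
    · exact ⟨1, by simpa using ((inner_eq_one_iff_of_norm_eq_one (hu i) (hv i)).1 h).symm⟩
    · refine ⟨-1, ?_⟩
      have : inner ℝ (u i) (-v i) = (1 : ℝ) := by rw [inner_neg_right, h, neg_neg]
      have := (inner_eq_one_iff_of_norm_eq_one (𝕜 := ℝ) (hu i) (by rw [norm_neg, hv])).1 this
      simp [this]
  choose σ hσ using h4
  refine ⟨σ, hσ, ?_⟩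
  have h5 : v = fun i => ((σ i : ℤ) : ℝ) • u i := funext hσ
  have h6 : segreVeronese d u ≠ 0 := by
    rw [← norm_ne_zero_iff, norm_segreVeronese]
    simp [hu]
  rw [h5, segreVeronese_smul, smul_smul] at h
  have h7 := smul_left_injective ℝ h6 h
  have h8 : ε = ε' * ∏ i, σ i ^ d i := by
    ext
    push_cast
    exact_mod_cast h7
  rw [h8, mul_assoc, Int.units_mul_self, mul_one]

theorem units_eq_of_smul_mem_ball {E : Type*} [NormedAddCommGroup E] [NormedSpace ℝ E] {δ : ℝ}
    (hδ : δ ≤ 1) {x p : E} (hx : ‖x‖ = 1) {s t : ℤˣ} (hs : ((s : ℤ) : ℝ) • x ∈ Metric.ball p δ)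
    (ht : ((t : ℤ) : ℝ) • x ∈ Metric.ball p δ) : s = t := by
  have h : dist (((s : ℤ) : ℝ) • x) (((t : ℤ) : ℝ) • x) < 2 := by
    rw [Metric.mem_ball] at hs ht
    linarith [dist_triangle_right (((s : ℤ) : ℝ) • x) (((t : ℤ) : ℝ) • x) p]
  rw [dist_eq_norm, ← sub_smul, norm_smul, hx, mul_one] at h
  rcases Int.units_eq_one_or s with rfl | rfl <;> rcases Int.units_eq_one_or t with rfl | rfl
  · rfl
  · norm_num at h
  · norm_num at h
  · rfl

/-- The fibre is parametrized by sign vectors `σ`, the global sign being forced to `ε₀ ∏ σ i ^ d i`.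
Distinct `σ` land in distinct pieces because a ball of radius at most `1` contains no antipodal pair
of unit vectors. -/
theorem card_pieces_containing {r : ℕ} {n d k : Fin r → ℕ} (hd : ∀ i, 1 ≤ d i)
    {δ : ℝ} (hδ : δ ≤ 1) {A : ∀ i, Fin (k i) → Set (EuclideanSpace ℝ (Fin (n i + 1)))}
    (hdisj : ∀ i, Pairwise (Function.onFun Disjoint (A i)))
    (hcov : ∀ i, ⋃ j, A i j = Metric.sphere 0 1)
    (hball : ∀ i j, ∃ p, ‖p‖ = 1 ∧ A i j ⊆ Metric.ball p δ)
    (ε₀ : ℤˣ) {u₀ : ∀ i, EuclideanSpace ℝ (Fin (n i + 1))} (hu₀ : ∀ i, ‖u₀ i‖ = 1) :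
    Nat.card {q : ℤˣ × (∀ i, Fin (k i)) // ((ε₀ : ℤ) : ℝ) • segreVeronese d u₀ ∈
      (fun u => ((q.1 : ℤ) : ℝ) • segreVeronese d u) '' Set.univ.pi fun i => A i (q.2 i)} =
      2 ^ r := by
  have hJ : ∀ i (s : ℤˣ), ∃ j, ((s : ℤ) : ℝ) • u₀ i ∈ A i j := by
    intro i s
    rw [← Set.mem_iUnion, hcov, mem_sphere_zero_iff_norm]
    rcases Int.units_eq_one_or s with h | h <;> simp [h, hu₀]
  choose J hJ using hJ
  have hsq : ∀ σ : Fin r → ℤˣ, (∏ i, σ i ^ d i) * ∏ i, σ i ^ d i = 1 :=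
    fun σ => Int.units_mul_self _
  have hcard : Nat.card (Fin r → ℤˣ) = 2 ^ r := by
    simp
  rw [← hcard]
  symm
  refine Nat.card_congr (Equiv.ofBijective (fun σ => ⟨(ε₀ * ∏ i, σ i ^ d i, fun i => J i (σ i)),
    fun i => ((σ i : ℤ) : ℝ) • u₀ i, fun i _ => hJ i (σ i), ?_⟩) ⟨?_, ?_⟩)
  · simp only [segreVeronese_smul, smul_smul]
    congr 1
    have := hsq σ
    have h : ε₀ * (∏ i, σ i ^ d i) * ∏ i, σ i ^ d i = ε₀ := by rw [mul_assoc, this, mul_one]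
    exact_mod_cast congrArg (fun e : ℤˣ => ((e : ℤ) : ℝ)) h
  · intro σ τ h
    have h1 := congrArg (fun q => q.1.2) h
    funext i
    have h2 : J i (σ i) = J i (τ i) := congrFun h1 i
    obtain ⟨p, -, hp⟩ := hball i (J i (σ i))
    exact units_eq_of_smul_mem_ball hδ (hu₀ i) (hp (hJ i _)) (hp (h2 ▸ hJ i _))
  · rintro ⟨⟨ε, j⟩, v, hv, h⟩
    have hv1 : ∀ i, ‖v i‖ = 1 := fun i => by
      have : v i ∈ ⋃ j, A i j := Set.mem_iUnion.2 ⟨_, hv i trivial⟩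
      rw [hcov] at this
      simpa using this
    obtain ⟨σ, hσ, hε⟩ := exists_unit_smul_of_segreVeronese_eq hd hu₀ hv1 h.symm
    refine ⟨σ, Subtype.ext (Prod.ext hε.symm (funext fun i => ?_))⟩
    by_contra hij
    refine Set.disjoint_left.1 (hdisj i hij) (hJ i (σ i)) ?_
    rw [← hσ]
    exact hv i trivial

/-! ### Summation over pieces and the limit `K → 1` -/

theorem le_of_forall_one_lt_le_pow_mul {a b : ℝ≥0∞} (N : ℕ)
    (h : ∀ K : ℝ≥0, 1 < K → a ≤ ((K : ℝ≥0∞) * K) ^ N * b) : a ≤ b := by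
  have hc : Filter.Tendsto (fun K : ℝ≥0 => ((K * K) ^ N : ℝ≥0)) (𝓝[>] 1) (𝓝 ((1 * 1) ^ N)) :=
    ((by fun_prop : Continuous fun K : ℝ≥0 => (K * K) ^ N).tendsto 1).mono_left nhdsWithin_le_nhds
  have h1 := ENNReal.Tendsto.mul_const (b := b) (ENNReal.tendsto_coe.2 hc) (Or.inl (by simp))
  simp only [mul_one, one_pow, ENNReal.coe_one, one_mul, ENNReal.coe_pow, ENNReal.coe_mul] at h1
  exact ge_of_tendsto h1 (eventually_nhdsWithin_of_forall fun K hK => h K hK)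

theorem exists_small_radius {K : ℝ} (hK : 1 < K) (D : ℝ) :
    ∃ δ : ℝ, 0 < δ ∧ δ ≤ 1 / 2 ∧ 1 ≤ K ^ 2 * (1 - δ ^ 2) ∧ 1 + D * (2 * δ ^ 2) ≤ K ^ 2 := by
  have hK2 : 1 < K ^ 2 := one_lt_pow₀ hK two_ne_zero
  have e1 : ∀ᶠ δ : ℝ in 𝓝 0, 1 < K ^ 2 * (1 - δ ^ 2) :=
    ((by fun_prop : Continuous fun δ : ℝ => K ^ 2 * (1 - δ ^ 2)).tendsto 0).eventually_const_lt
      (by simpa using hK2)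
  have e2 : ∀ᶠ δ : ℝ in 𝓝 0, 1 + D * (2 * δ ^ 2) < K ^ 2 :=
    ((by fun_prop : Continuous fun δ : ℝ => 1 + D * (2 * δ ^ 2)).tendsto 0).eventually_lt_const
      (by simpa using hK2)
  have e3 : ∀ᶠ δ : ℝ in 𝓝 0, δ < 1 / 2 := eventually_lt_nhds (by norm_num)
  have e := ((e1.and (e2.and e3)).filter_mono nhdsWithin_le_nhds).and
    (self_mem_nhdsWithin : Set.Ioi (0 : ℝ) ∈ 𝓝[>] 0)
  obtain ⟨δ, ⟨h1, h2, h3⟩, h4⟩ := e.exists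
  exact ⟨δ, h4, h3.le, h1.le, h2.le⟩

theorem two_pow_mul_vol_manifold_bounds {r : ℕ} (hr : 1 ≤ r) {n d : Fin r → ℕ}
    (hd : ∀ i, 1 ≤ d i) {K : ℝ≥0} (hK : 1 < K) :
    2 ^ r * μHE[∑ i, n i] (manifold n d) ≤ ((K : ℝ≥0∞) * K) ^ (∑ i, n i) *
        (2 * ∏ i, (‖√(d i : ℝ)‖₊ : ℝ≥0∞) ^ n i * μHE[n i] (unitSphere (n i))) ∧
      2 * ∏ i, (‖√(d i : ℝ)‖₊ : ℝ≥0∞) ^ n i * μHE[n i] (unitSphere (n i)) ≤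
        ((K : ℝ≥0∞) * K) ^ (∑ i, n i) * (2 ^ r * μHE[∑ i, n i] (manifold n d)) := by
  have hK' : (1 : ℝ) < K := by exact_mod_cast hK
  obtain ⟨δ, hδ0, hδ, h1, h2⟩ := exists_small_radius hK' (∑ i, (d i : ℝ))
  rw [Finset.sum_mul] at h2
  have h3 : 2 * δ ^ 2 ≤ 1 := by nlinarith
  choose k A hAm hdisj hcov hball using fun i =>
    exists_sphere_partition (E := EuclideanSpace ℝ (Fin (n i + 1))) hδ0
  have hS : ∀ i j, A i j ⊆ Metric.sphere 0 1 := fun i j => hcov i ▸ Set.subset_iUnion (A i) j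
  have : FiniteDimensional ℝ (TensorSpace n d) := (tensorBasis n d).finiteDimensional_of_finite
  let P : ℤˣ × (∀ i, Fin (k i)) → Set (TensorSpace n d) := fun q =>
    (fun u => ((q.1 : ℤ) : ℝ) • segreVeronese d u) '' Set.univ.pi fun i => A i (q.2 i)
  have hbounds := fun q : ℤˣ × (∀ i, Fin (k i)) => volume_image_product_bounds hd h1 h2 h3
    (A := fun i => A i (q.2 i)) (fun i => hball i _) (fun i => hS i _) (abs_units_cast q.1)
  have hP : ∀ q, MeasurableSet (P q) := by
    -- Lusin–Souslin: an injective continuous image of a Borel set is Borel. Injectivity holds since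
    -- a small piece contains no antipodal points.
    refine fun q => (MeasurableSet.univ_pi fun i => hAm i _).image_of_continuousOn_injOn
      (Continuous.continuousOn (by
        have := continuous_segreVeronese (n := n) d
        fun_prop)) fun u hu v hv huv => ?_
    obtain ⟨σ, hσ, -⟩ := exists_unit_smul_of_segreVeronese_eq hd
      (fun i => mem_sphere_zero_iff_norm.1 (hS i _ (hu i trivial)))
      (fun i => mem_sphere_zero_iff_norm.1 (hS i _ (hv i trivial))) huv
    funext i
    obtain ⟨p, -, hp⟩ := hball i (q.2 i)
    have hσi : 1 = σ i := units_eq_of_smul_mem_ball (hδ.trans (by norm_num))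
      (mem_sphere_zero_iff_norm.1 (hS i _ (hu i trivial)))
      (hp (by simpa using hu i trivial)) (hp (hσ i ▸ hv i trivial))
    simp [hσ i, ← hσi]
  have hPX : ⋃ q, P q = manifold n d := by
    ext F
    rw [mem_manifold_iff hr hd, Set.mem_iUnion]
    constructor
    · rintro ⟨q, u, hu, rfl⟩
      exact ⟨q.1, u, fun i => mem_sphere_zero_iff_norm.1 (hS i _ (hu i trivial)), rfl⟩
    · rintro ⟨ε, u, hu, rfl⟩
      have h : ∀ i, ∃ j, u i ∈ A i j := fun i => by
        rw [← Set.mem_iUnion, hcov, mem_sphere_zero_iff_norm, hu]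
      choose j hj using h
      exact ⟨(ε, j), u, fun i _ => hj i, rfl⟩
  have hsum : ∑ q, μHE[∑ i, n i] (P q) = 2 ^ r * μHE[∑ i, n i] (manifold n d) := by
    rw [sum_measure_eq_card_mul _ hP hPX (N := 2 ^ r)]
    · simp
    · intro F hF
      obtain ⟨ε, u, hu, rfl⟩ := (mem_manifold_iff hr hd F).1 hF
      exact card_pieces_containing hd (by linarith) hdisj hcov hball ε hu
  have hprod : ∑ q : ℤˣ × (∀ i, Fin (k i)),
      ∏ i, (‖√(d i : ℝ)‖₊ : ℝ≥0∞) ^ n i * μHE[n i] (A i (q.2 i)) =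
      2 * ∏ i, (‖√(d i : ℝ)‖₊ : ℝ≥0∞) ^ n i * μHE[n i] (unitSphere (n i)) := by
    have hsphere : ∀ i, μHE[n i] (unitSphere (n i)) = ∑ j, μHE[n i] (A i j) := fun i => by
      rw [unitSphere, ← hcov i, measure_iUnion (hdisj i) (hAm i), tsum_fintype]
    simp only [hsphere, Finset.mul_sum, Fintype.sum_prod_type]
    rw [Finset.prod_univ_sum]
    simp [Fintype.piFinset_univ]
  have hKK : (K : ℝ≥0∞) ≤ K * K := by
    rw [← ENNReal.coe_mul, ENNReal.coe_le_coe]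
    exact le_mul_of_one_le_right' hK.le
  rw [← hsum, ← hprod, Finset.mul_sum, Finset.mul_sum]
  constructor
  · refine Finset.sum_le_sum fun q _ => (hbounds q).1.trans ?_
    gcongr
  · exact Finset.sum_le_sum fun q _ => (hbounds q).2

end SegreVeronese

end

theorem lemma5p1 (r : ℕ) (hr : 1 ≤ r) (n d : Fin r → ℕ) (hn : ∀ i, 1 ≤ n i) (hd : ∀ i, 1 ≤ d i) :
    SegreVeronese.vol (∑ i, n i) (SegreVeronese.manifold n d) =
      ENNReal.ofReal (√(∏ i, (d i : ℝ) ^ n i) / 2 ^ (r - 1)) *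
        ∏ i, SegreVeronese.vol (n i) (SegreVeronese.unitSphere (n i)) := by
  have h := le_antisymm
    (SegreVeronese.le_of_forall_one_lt_le_pow_mul (∑ i, n i) fun K hK =>
      (SegreVeronese.two_pow_mul_vol_manifold_bounds hr (n := n) hd hK).1)
    (SegreVeronese.le_of_forall_one_lt_le_pow_mul (∑ i, n i) fun K hK =>
      (SegreVeronese.two_pow_mul_vol_manifold_bounds hr (n := n) hd hK).2)
  -- The `2` from the global sign cancels one factor of `2 ^ r`, leaving `2 ^ (r - 1)`.
  obtain ⟨s, rfl⟩ : ∃ s, r = s + 1 := ⟨r - 1, by omega⟩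
  have hscale : ∏ i, (‖√(d i : ℝ)‖₊ : ENNReal) ^ n i =
      ENNReal.ofReal (√(∏ i, (d i : ℝ) ^ n i)) := by
    rw [Real.sqrt_prod _ fun i _ => by positivity, ENNReal.ofReal_prod_of_nonneg
      fun i _ => Real.sqrt_nonneg _]
    refine Finset.prod_congr rfl fun i _ => ?_
    have hpow : √((d i : ℝ) ^ n i) = √(d i : ℝ) ^ n i := by
      rw [Real.sqrt_eq_iff_mul_self_eq (by positivity) (by positivity), ← mul_pow,
        Real.mul_self_sqrt (Nat.cast_nonneg _)]
    rw [hpow, ← ENNReal.coe_pow, ← nnnorm_pow, ← ENNReal.ofReal_coe_nnreal, coe_nnnorm,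
      Real.norm_of_nonneg (pow_nonneg (Real.sqrt_nonneg _) _)]
  rw [Finset.prod_mul_distrib, hscale, pow_succ', mul_assoc] at h
  have h' := (ENNReal.mul_right_inj two_ne_zero ENNReal.ofNat_ne_top).1 h
  simp only [SegreVeronese.vol, Nat.add_sub_cancel]
  rw [ENNReal.ofReal_div_of_pos (by positivity), ENNReal.ofReal_pow (by norm_num),
    ENNReal.ofReal_ofNat, mul_comm, ← mul_div_assoc, mul_comm _ (ENNReal.ofReal _), ← h',
    mul_comm (2 ^ s), ENNReal.mul_div_cancel_right (by simp) (by simp)]
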